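/- **Setting.** Let $B_1$ be the open unit ball of $\mathbb R^d$. For $g\in H^1(B_1)$ consider one of the following two problems. * *Obstacle problem* ($d\ge 1$, $g\ge 0$ a.e. in $B_1$): $\mathcal F(u)=\frac12\int_{B_1}|\nabla u|^2\,dx+\int_{B_1}u\,dx$, $\ \mathcal K=\{u\in H^1(B_1): u-g\in H^1_0(B_1),\ u\ge 0 \text{ a.e. in } B_1\}$, and $\Omega'=B_1$. * *Thin-obstacle problem* ($d\ge 2$, $g$ even with respect to $\{x_d=0\}$ and $g\ge 0$ on $B_1\cap\{x_d=0\}$ in the sense of traces): $\mathcal F(u)=\frac12\int_{B_1}|\nabla u|^2\,dx$, $\ \mathcal K=\{u\in H^1(B_1): u-g\in H^1_0(B_1),\ u\ge0 \text{ on } B_1\cap\{x_d=0\} \text{ in the sense of traces},\ u \text{ even with respect to } \{x_d=0\}\}$, and $\Omega'=B_1\cap\{x_d>0\}$. Write $\delta\mathcal F(u)[w]=\lim_{s\to0}\frac{\mathcal F(u+sw)-\mathcal F(u)}{s}$. A *global strong solution* of the parabolic problem is a map $u:[0,\infty)\to\mathcal K$ such that $u\in C([0,\infty);L^2(B_1))\cap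 H^1_{loc}((0,\infty);L^2(B_1))$, the restriction of $u$ to $\Omega'$ belongs to $L^2_{loc}((0,\infty);H^2(\Omega'))$, and for every $v\in\mathcal K$ and almost every $t>0$ $$\int_{B_1}u'(t)\,(v-u(t))\,dx+\delta\mathcal F(u(t))[v-u(t)]\ge 0 .$$ **Theorem 1.4.** In each of the two problems, the functional $\mathcal F$ has a unique minimizer $\varphi$ in $\mathcal K$. If $u$ is a global strong solution of the corresponding parabolic problem with the same boundary datum $g$, then $u(t)\to\varphi$ strongly in $H^1(B_1)$ as $t\to\infty$, and there are constants $C>0$ and $M>0$, which may depend on $u$, such that $$\|u(t)-\varphi\|_{H^1(B_1)}\le M e^{-Ct}\qquad\text{for every } t\ge 1 .$$ -/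

import Mathlib

open MeasureTheory Set Filter Topology
open scoped ContDiff

noncomputable section

namespace ObstacleFlow

/-! ## Sobolev spaces on an open set -/

/-- Euclidean space `ℝ^d`. -/
abbrev E (d : ℕ) := EuclideanSpace ℝ (Fin d)

/-- The open unit ball `B₁` of `ℝ^d`. -/
def ball1 (d : ℕ) : Set (E d) := Metric.ball 0 1

/-- `L²(Ω)`. -/
abbrev L2 {d : ℕ} (Ω : Set (E d)) := Lp ℝ 2 (volume.restrict Ω)

/-- Square integrable vector fields on `Ω`. -/
abbrev L2V {d : ℕ} (Ω : Set (E d)) := Lp (E d) 2 (volume.restrict Ω)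

/-- `ψ ∈ C_c^∞(Ω)`. -/
structure IsTest {d : ℕ} (Ω : Set (E d)) (ψ : E d → ℝ) : Prop where
  smooth : ContDiff ℝ ∞ ψ
  compact : HasCompactSupport ψ
  supp : tsupport ψ ⊆ Ω

/-- `G` is the weak gradient of `u` in `Ω`. -/
def IsWeakGrad {d : ℕ} (Ω : Set (E d)) (u : L2 Ω) (G : L2V Ω) : Prop :=
  ∀ ψ : E d → ℝ, IsTest Ω ψ → ∀ e : E d,
    ∫ x in Ω, u x * fderiv ℝ ψ x e = -∫ x in Ω, inner ℝ (G x) e * ψ x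

theorem IsTest.memLp {d : ℕ} {Ω : Set (E d)} {ψ : E d → ℝ} (h : IsTest Ω ψ) :
    MemLp ψ 2 (volume.restrict Ω) :=
  (h.smooth.continuous.memLp_of_hasCompactSupport h.compact).restrict Ω

theorem IsTest.memLp_fderiv {d : ℕ} {Ω : Set (E d)} {ψ : E d → ℝ} (h : IsTest Ω ψ) (e : E d) :
    MemLp (fun x => fderiv ℝ ψ x e) 2 (volume.restrict Ω) := by
  have hc : Continuous fun x => fderiv ℝ ψ x e :=
    (h.smooth.continuous_fderiv (by simp)).clm_apply continuous_const
  exact (hc.memLp_of_hasCompactSupport (h.compact.fderiv_apply ℝ e)).restrict Ω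

theorem IsTest.integrable_left {d : ℕ} {Ω : Set (E d)} {ψ : E d → ℝ} (h : IsTest Ω ψ)
    (u : L2 Ω) (e : E d) : Integrable (fun x => u x * fderiv ℝ ψ x e) (volume.restrict Ω) :=
  (Lp.memLp u).integrable_mul (h.memLp_fderiv e)

theorem IsTest.integrable_right {d : ℕ} {Ω : Set (E d)} {ψ : E d → ℝ} (h : IsTest Ω ψ)
    (G : L2V Ω) (e : E d) :
    Integrable (fun x => inner ℝ (G x) e * ψ x) (volume.restrict Ω) :=
  ((Lp.memLp G).inner_const e).integrable_mul h.memLp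

theorem IsWeakGrad.zero {d : ℕ} (Ω : Set (E d)) : IsWeakGrad Ω 0 0 := by
  intro ψ _ e
  have h1 : ∫ x in Ω, (0 : L2 Ω) x * fderiv ℝ ψ x e = 0 := by
    refine integral_eq_zero_of_ae ?_
    filter_upwards [Lp.coeFn_zero ℝ 2 (volume.restrict Ω)] with x hx
    rw [hx]; simp
  have h2 : ∫ x in Ω, inner ℝ ((0 : L2V Ω) x) e * ψ x = 0 := by
    refine integral_eq_zero_of_ae ?_
    filter_upwards [Lp.coeFn_zero (E d) 2 (volume.restrict Ω)] with x hx
    rw [hx]; simp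
  rw [h1, h2, neg_zero]

theorem IsWeakGrad.add {d : ℕ} {Ω : Set (E d)} {u v : L2 Ω} {G H : L2V Ω}
    (hu : IsWeakGrad Ω u G) (hv : IsWeakGrad Ω v H) : IsWeakGrad Ω (u + v) (G + H) := by
  intro ψ hψ e
  have h1 : ∫ x in Ω, (u + v : L2 Ω) x * fderiv ℝ ψ x e
      = ∫ x in Ω, (u x * fderiv ℝ ψ x e + v x * fderiv ℝ ψ x e) := by
    refine integral_congr_ae ?_
    filter_upwards [Lp.coeFn_add u v] with x hx
    rw [hx, Pi.add_apply, add_mul]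
  have h2 : ∫ x in Ω, inner ℝ ((G + H : L2V Ω) x) e * ψ x
      = ∫ x in Ω, (inner ℝ (G x) e * ψ x + inner ℝ (H x) e * ψ x) := by
    refine integral_congr_ae ?_
    filter_upwards [Lp.coeFn_add G H] with x hx
    rw [hx, Pi.add_apply, inner_add_left, add_mul]
  rw [h1, h2, integral_add (hψ.integrable_left u e) (hψ.integrable_left v e),
    integral_add (hψ.integrable_right G e) (hψ.integrable_right H e), hu ψ hψ e, hv ψ hψ e]
  ring

theorem IsWeakGrad.smul {d : ℕ} {Ω : Set (E d)} {u : L2 Ω} {G : L2V Ω} (c : ℝ)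
    (hu : IsWeakGrad Ω u G) : IsWeakGrad Ω (c • u) (c • G) := by
  intro ψ hψ e
  have h1 : ∫ x in Ω, (c • u : L2 Ω) x * fderiv ℝ ψ x e
      = ∫ x in Ω, c * (u x * fderiv ℝ ψ x e) := by
    refine integral_congr_ae ?_
    filter_upwards [Lp.coeFn_smul c u] with x hx
    rw [hx, Pi.smul_apply, smul_eq_mul, mul_assoc]
  have h2 : ∫ x in Ω, inner ℝ ((c • G : L2V Ω) x) e * ψ x
      = ∫ x in Ω, c * (inner ℝ (G x) e * ψ x) := by
    refine integral_congr_ae ?_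
    filter_upwards [Lp.coeFn_smul c G] with x hx
    rw [hx, Pi.smul_apply, real_inner_smul_left, mul_assoc]
  rw [h1, h2, integral_const_mul, integral_const_mul, hu ψ hψ e]
  ring

/-- The Sobolev space `H¹(Ω)`: pairs `(u, ∇u)` of a function `u ∈ L²(Ω)` and its weak gradient
`∇u ∈ L²(Ω)`. It carries the norm `‖u‖_{H¹}² = ‖u‖_{L²}² + ‖∇u‖_{L²}²`. -/
def H1 {d : ℕ} (Ω : Set (E d)) : Submodule ℝ (WithLp 2 (L2 Ω × L2V Ω)) where
  carrier := {p | IsWeakGrad Ω p.fst p.snd}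
  zero_mem' := IsWeakGrad.zero Ω
  add_mem' := fun hp hq => IsWeakGrad.add hp hq
  smul_mem' := fun c _ hp => IsWeakGrad.smul c hp

/-- The function underlying an element of `H¹(Ω)`, as an element of `L²(Ω)`. -/
def fn {d : ℕ} {Ω : Set (E d)} (u : H1 Ω) : L2 Ω := (u : WithLp 2 (L2 Ω × L2V Ω)).fst

/-- The weak gradient of an element of `H¹(Ω)`. -/
def grad {d : ℕ} {Ω : Set (E d)} (u : H1 Ω) : L2V Ω := (u : WithLp 2 (L2 Ω × L2V Ω)).snd

/-- `H¹₀(Ω)`: the closure of `C_c^∞(Ω)` in `H¹(Ω)`. -/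
def H10 {d : ℕ} (Ω : Set (E d)) : Set (H1 Ω) :=
  closure {w | ∃ ψ : E d → ℝ, IsTest Ω ψ ∧ fn w =ᵐ[volume.restrict Ω] ψ ∧
    grad w =ᵐ[volume.restrict Ω] fun x => gradient ψ x}

/-! ## Parabolic variational inequalities -/

/-- The curve `t ↦ u t` belongs to `L²_loc(]0,∞[; H²(Ω'))`, where `Ω' ⊆ Ω`: for almost every
`t > 0` the restriction `w t` of `u t` to `Ω'` is in `H¹(Ω')` together with its partial derivatives
`D i t = ∂ᵢ(w t)`, and the curves `w`, `D i` with values in `H¹(Ω')` are locally square integrable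
on `]0,∞[`. -/
def L2locH2 {d : ℕ} {Ω : Set (E d)} (Ω' : Set (E d)) (u : ℝ → H1 Ω) : Prop :=
  ∃ (w : ℝ → H1 Ω') (D : Fin d → ℝ → H1 Ω'),
    (∀ᵐ t ∂(volume.restrict (Ioi (0 : ℝ))),
      fn (w t) =ᵐ[volume.restrict Ω'] fn (u t) ∧
      ∀ i, fn (D i t) =ᵐ[volume.restrict Ω'] fun x => grad (w t) x i) ∧
    ∀ a b : ℝ, 0 < a → a ≤ b →
      MemLp w 2 (volume.restrict (Icc a b)) ∧ ∀ i, MemLp (D i) 2 (volume.restrict (Icc a b))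

/-- `u'` is the time derivative of `u ∈ H¹_loc(]0,∞[; L²(Ω))`: it is locally square integrable on
`]0,∞[`, and `u t - u s` is the integral of `u'` from `s` to `t`. -/
def IsTimeDeriv {d : ℕ} {Ω : Set (E d)} (u u' : ℝ → L2 Ω) : Prop :=
  (∀ a b : ℝ, 0 < a → a ≤ b → MemLp u' 2 (volume.restrict (Icc a b))) ∧
    ∀ s t : ℝ, 0 < s → s ≤ t → u t - u s = ∫ τ in s..t, u' τ

/-- The first variation `w · ∇F(u) = lim_{s → 0} (F(u + s w) - F(u)) / s`. -/
def firstVariation {d : ℕ} {Ω : Set (E d)} (F : H1 Ω → ℝ) (u w : H1 Ω) : ℝ :=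
  deriv (fun s : ℝ => F (u + s • w)) 0

/-- `φ` is a solution of the stationary problem `min_{u ∈ K} F(u)`. -/
def IsMinimizer {d : ℕ} {Ω : Set (E d)} (F : H1 Ω → ℝ) (K : Set (H1 Ω)) (φ : H1 Ω) : Prop :=
  φ ∈ K ∧ ∀ v ∈ K, F φ ≤ F v

/-- `u` is a global strong solution of the parabolic variational inequality
`(u'(t) + ∇F(u(t))) · (v - u(t)) ≥ 0` for every `v ∈ K` and almost every `t > 0`, with initial
datum `u(0) ∈ K`. Only the values `u t` with `0 ≤ t` matter. The time slices are of class `H²` in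
the open set `Ω' ⊆ Ω`. -/
structure IsStrongSolution {d : ℕ} {Ω : Set (E d)} (F : H1 Ω → ℝ) (K : Set (H1 Ω))
    (Ω' : Set (E d)) (u : ℝ → H1 Ω) : Prop where
  mem : ∀ t, 0 ≤ t → u t ∈ K
  continuousOn : ContinuousOn (fun t => fn (u t)) (Ici 0)
  regular : L2locH2 Ω' u
  inequality : ∃ u' : ℝ → L2 Ω, IsTimeDeriv (fun t => fn (u t)) u' ∧
    ∀ v ∈ K, ∀ᵐ t ∂(volume.restrict (Ioi (0 : ℝ))),
      0 ≤ inner ℝ (u' t) (fn (v - u t)) + firstVariation F (u t) (v - u t)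

/-! ## The obstacle problem -/

/-- The obstacle energy `½ ∫_{B₁} |∇u|² + ∫_{B₁} u`. -/
def Fob {d : ℕ} (u : H1 (ball1 d)) : ℝ :=
  1 / 2 * (∫ x in ball1 d, ‖grad u x‖ ^ 2) + ∫ x in ball1 d, fn u x

/-- `u ≥ 0` almost everywhere in `B₁`. -/
def Nonneg {d : ℕ} (u : H1 (ball1 d)) : Prop := ∀ᵐ x ∂(volume.restrict (ball1 d)), 0 ≤ fn u x

/-- The admissible set of the obstacle problem with boundary datum `g`. -/
def Kob {d : ℕ} (g : H1 (ball1 d)) : Set (H1 (ball1 d)) :=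
  {u | u - g ∈ H10 (ball1 d) ∧ Nonneg u}

/-! ## The thin-obstacle problem

The space is `ℝ^d` with `d = n + 1`, and `x_d` is the coordinate of index `Fin.last n`. -/

/-- The reflection `(x', x_d) ↦ (x', -x_d)`. -/
def reflect {n : ℕ} (x : E (n + 1)) : E (n + 1) :=
  WithLp.toLp 2 fun i => if i = Fin.last n then -x i else x i

/-- The half ball `B₁⁺ = B₁ ∩ {x_d > 0}`. -/
def halfBall (n : ℕ) : Set (E (n + 1)) := ball1 (n + 1) ∩ {x | 0 < x (Fin.last n)}

/-- `u` is even with respect to the hyperplane `{x_d = 0}`. -/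
def IsEven {n : ℕ} (u : H1 (ball1 (n + 1))) : Prop :=
  ∀ᵐ x ∂(volume.restrict (ball1 (n + 1))), fn u (reflect x) = fn u x

/-- The trace of `u ∈ H¹(B₁)` on `B₁ ∩ {x_d = 0}`, tested against `ψ ∈ C_c^∞(B₁)`: the integral of
`(tr u) ψ` over `B₁ ∩ {x_d = 0}`, which by the Gauss-Green formula in `B₁⁺` is
`-∫_{B₁⁺} (u ∂_dψ + ψ ∂_d u)`. -/
def thinTrace {n : ℕ} (u : H1 (ball1 (n + 1))) (ψ : E (n + 1) → ℝ) : ℝ :=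
  -∫ x in halfBall n, (fn u x * fderiv ℝ ψ x (EuclideanSpace.single (Fin.last n) 1)
    + grad u x (Fin.last n) * ψ x)

/-- `u ≥ 0` on `B₁ ∩ {x_d = 0}` in the sense of traces. -/
def ThinNonneg {n : ℕ} (u : H1 (ball1 (n + 1))) : Prop :=
  ∀ ψ : E (n + 1) → ℝ, IsTest (ball1 (n + 1)) ψ → (∀ x, 0 ≤ ψ x) → 0 ≤ thinTrace u ψ

/-- The thin-obstacle energy `½ ∫_{B₁} |∇u|²`. -/
def Fth {n : ℕ} (u : H1 (ball1 (n + 1))) : ℝ :=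
  1 / 2 * ∫ x in ball1 (n + 1), ‖grad u x‖ ^ 2

/-- The admissible set of the thin-obstacle problem with boundary datum `g`. -/
def Kth {n : ℕ} (g : H1 (ball1 (n + 1))) : Set (H1 (ball1 (n + 1))) :=
  {u | u - g ∈ H10 (ball1 (n + 1)) ∧ ThinNonneg u ∧ IsEven u}

/-! ## The first variations of the two energies -/

theorem fn_add_smul {d : ℕ} {Ω : Set (E d)} (u w : H1 Ω) (s : ℝ) :
    fn (u + s • w) = fn u + s • fn w := by
  simp only [fn, Submodule.coe_add, Submodule.coe_smul, WithLp.add_fst, WithLp.smul_fst]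

theorem grad_add_smul {d : ℕ} {Ω : Set (E d)} (u w : H1 Ω) (s : ℝ) :
    grad (u + s • w) = grad u + s • grad w := by
  simp only [grad, Submodule.coe_add, Submodule.coe_smul, WithLp.add_snd, WithLp.smul_snd]

theorem inner_expand {V : Type*} [NormedAddCommGroup V] [InnerProductSpace ℝ V] (G H : V) (s : ℝ) :
    (inner ℝ (G + s • H) (G + s • H) : ℝ)
      = inner ℝ G G + 2 * s * inner ℝ G H + s ^ 2 * inner ℝ H H := by
  rw [inner_add_left, inner_add_right, inner_add_right, real_inner_smul_left,
    real_inner_smul_left, real_inner_smul_right, real_inner_smul_right, real_inner_comm G H]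
  ring

theorem integral_norm_sq_line {d : ℕ} {Ω : Set (E d)} (u w : H1 Ω) (s : ℝ) :
    ∫ x in Ω, ‖grad (u + s • w) x‖ ^ 2 = (∫ x in Ω, ‖grad u x‖ ^ 2)
      + 2 * s * (∫ x in Ω, inner ℝ (grad u x) (grad w x))
      + s ^ 2 * ∫ x in Ω, ‖grad w x‖ ^ 2 := by
  have key : ∀ G : L2V Ω, ∫ x in Ω, ‖G x‖ ^ 2 = inner ℝ G G := fun G => by
    rw [L2.inner_def]
    simp only [real_inner_self_eq_norm_sq]
  have key2 : ∫ x in Ω, inner ℝ (grad u x) (grad w x) = inner ℝ (grad u) (grad w) := by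
    rw [L2.inner_def]
  have key3 : ∫ x in Ω, ‖grad (u + s • w) x‖ ^ 2
      = inner ℝ (grad u + s • grad w) (grad u + s • grad w) :=
    grad_add_smul u w s ▸ key (grad (u + s • w))
  rw [key3, key (grad u), key (grad w), key2]
  exact inner_expand _ _ s

theorem firstVariation_Fth {n : ℕ} (u w : H1 (ball1 (n + 1))) :
    firstVariation Fth u w = ∫ x in ball1 (n + 1), inner ℝ (grad u x) (grad w x) := by
  have h : ∀ a b c : ℝ, HasDerivAt (fun s : ℝ => 1 / 2 * (a + 2 * s * b + s ^ 2 * c)) b 0 := by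
    intro a b c
    have := ((((hasDerivAt_id (0 : ℝ)).const_mul 2).mul_const b).const_add a).add
      (((hasDerivAt_id (0 : ℝ)).pow 2).mul_const c) |>.const_mul (1 / 2)
    exact this.congr_deriv (by simp)
  have e : (fun s : ℝ => Fth (u + s • w)) = _ :=
    funext fun s => congrArg (fun r : ℝ => 1 / 2 * r) (integral_norm_sq_line u w s)
  rw [firstVariation, e]
  exact (h _ _ _).deriv

theorem firstVariation_Fob {d : ℕ} (u w : H1 (ball1 d)) :
    firstVariation Fob u w = (∫ x in ball1 d, inner ℝ (grad u x) (grad w x))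
      + ∫ x in ball1 d, fn w x := by
  have h : ∀ a b c e f : ℝ,
      HasDerivAt (fun s : ℝ => 1 / 2 * (a + 2 * s * b + s ^ 2 * c) + (e + s * f)) (b + f) 0 := by
    intro a b c e f
    have := (((((hasDerivAt_id (0 : ℝ)).const_mul 2).mul_const b).const_add a).add
      (((hasDerivAt_id (0 : ℝ)).pow 2).mul_const c) |>.const_mul (1 / 2)).add
      (((hasDerivAt_id (0 : ℝ)).mul_const f).const_add e)
    exact this.congr_deriv (by simp)
  have : Fact (volume (ball1 d) < ⊤) := ⟨measure_ball_lt_top⟩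
  have hi : ∀ v : L2 (ball1 d), Integrable v (volume.restrict (ball1 d)) := fun v =>
    (Lp.memLp v).integrable (by norm_num)
  have hl : ∀ s : ℝ, ∫ x in ball1 d, fn (u + s • w) x
      = (∫ x in ball1 d, fn u x) + s * ∫ x in ball1 d, fn w x := by
    intro s
    rw [← integral_const_mul, ← integral_add (hi _) ((hi _).const_mul s)]
    refine integral_congr_ae ?_
    rw [fn_add_smul]
    filter_upwards [Lp.coeFn_add (fn u) (s • fn w), Lp.coeFn_smul s (fn w)] with x h1 h2
    rw [h1, Pi.add_apply, h2, Pi.smul_apply, smul_eq_mul]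
  have e : (fun s : ℝ => Fob (u + s • w)) = _ :=
    funext fun s =>
      congrArg₂ (fun r q : ℝ => 1 / 2 * r + q) (integral_norm_sq_line u w s) (hl s)
  rw [firstVariation, e]
  exact (h _ _ _ _ _).deriv

end ObstacleFlow

end

open ObstacleFlow

/-! ## A Grönwall inequality for absolutely continuous curves in a Hilbert space -/

/-! Both problems concern an energy ½‖∇v‖² + ℓ(v) on a closed convex set K whose differences lie in
H¹₀(B₁). There Poincaré's inequality (`norm_le_of_mem_H10`) gives ‖v - w‖ ≤ κ‖∇(v - w)‖ with κ = 3,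
so the energy is uniformly convex on K; minimizing sequences are Cauchy and the minimizer is unique
(`existsUnique_minimizer`).

For the flow, testing the inequalities of two solutions against each other gives ½ d/dt ‖u - v‖² ≤
-‖∇(u - v)‖² in L² (`SolvesVI.dissipation`), hence exponential contraction in L² at rate κ⁻²
(`IsEvolution.contraction`). Comparing u with the constant solution φ makes u - φ decay in L²;
comparing u with its own time translates makes the velocity u' decay (`exists_norm_velocity_le`).
The dissipation inequality against φ also reads ‖∇(u - φ)‖² ≤ ‖u'‖ ‖u - φ‖, so L² decay upgrades to
H¹ decay at almost every time. Every t ≥ 1 is then reached as a limit of such times, along which u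
is Cauchy in H¹ (`IsEvolution.exists_norm_sub_le`). -/

theorem AbsolutelyContinuousOnInterval.of_dist_le {X Y : Type*} [PseudoMetricSpace X]
    [PseudoMetricSpace Y] {f : ℝ → X} {g : ℝ → Y} {a b : ℝ}
    (hg : AbsolutelyContinuousOnInterval g a b)
    (h : ∀ x ∈ uIcc a b, ∀ y ∈ uIcc a b, dist (f x) (f y) ≤ dist (g x) (g y)) :
    AbsolutelyContinuousOnInterval f a b := by
  rw [absolutelyContinuousOnInterval_iff] at hg ⊢
  intro ε hε
  obtain ⟨δ, hδ, H⟩ := hg ε hε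
  refine ⟨δ, hδ, fun I hI hIδ => lt_of_le_of_lt (Finset.sum_le_sum fun i hi => ?_) (H I hI hIδ)⟩
  exact h _ (hI.1 i hi).1 _ (hI.1 i hi).2

section Gronwall

variable {H : Type*} [NormedAddCommGroup H] [InnerProductSpace ℝ H]

/-- By the reverse triangle inequality, increments of the norm are dominated by those of the real
primitive of ‖z'‖, which is absolutely continuous. -/
theorem absolutelyContinuousOnInterval_norm_primitive {z' : ℝ → H} {s t : ℝ} (c : H)
    (hint : IntervalIntegrable z' volume s t) :
    AbsolutelyContinuousOnInterval (fun x => ‖c + ∫ τ in s..x, z' τ‖) s t := by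
  refine (hint.norm.absolutelyContinuousOnInterval_intervalIntegral
    (c := s) left_mem_uIcc).of_dist_le fun x hx y hy => ?_
  have hsub : ∀ x ∈ uIcc s t, IntervalIntegrable z' volume s x := fun x hx =>
    hint.mono_set (uIcc_subset_uIcc left_mem_uIcc hx)
  refine (abs_norm_sub_norm_le _ _).trans ?_
  rw [add_sub_add_left_eq_sub, intervalIntegral.integral_interval_sub_left (hsub x hx) (hsub y hy),
    Real.dist_eq, intervalIntegral.integral_interval_sub_left (hsub x hx).norm (hsub y hy).norm]
  exact intervalIntegral.norm_integral_le_abs_integral_norm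

/-- The function e^{2c(x-s)}‖z(x)‖² is absolutely continuous with nonpositive derivative almost
everywhere, so it does not increase from s to t. -/
theorem norm_le_exp_mul_of_inner_deriv_le [CompleteSpace H] {z z' : ℝ → H} {s t c : ℝ} (hst : s ≤ t)
    (hint : IntervalIntegrable z' volume s t)
    (hz : ∀ x ∈ Icc s t, z x = z s + ∫ τ in s..x, z' τ)
    (hd : ∀ᵐ x, x ∈ Ioc s t → inner ℝ (z' x) (z x) ≤ -c * ‖z x‖ ^ 2) :
    ‖z t‖ ≤ Real.exp (-c * (t - s)) * ‖z s‖ := by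
  -- Outside [s, t] nothing is known about z; its primitive agrees with it there and can be
  -- differentiated almost everywhere, end points included.
  set Z : ℝ → H := fun x => z s + ∫ τ in s..x, z' τ with hZ
  have hac := absolutelyContinuousOnInterval_norm_primitive (z s) hint
  have hexp : AbsolutelyContinuousOnInterval (fun x : ℝ => Real.exp (2 * c * (x - s))) s t :=
    ContDiffOn.absolutelyContinuousOnInterval (by fun_prop)
  have hE : AbsolutelyContinuousOnInterval
      (fun x => Real.exp (2 * c * (x - s)) * (‖Z x‖ * ‖Z x‖)) s t :=
    hexp.fun_mul (hac.fun_mul hac)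
  have hle : ∫ x in s..t, deriv (fun x => Real.exp (2 * c * (x - s)) * (‖Z x‖ * ‖Z x‖)) x ≤ 0 := by
    rw [intervalIntegral.integral_of_le hst]
    refine setIntegral_nonpos_ae measurableSet_Ioc ?_
    filter_upwards [hint.ae_hasDerivAt_integral, hd] with x hx1 hx2 hx
    have hxI : x ∈ Icc s t := Ioc_subset_Icc_self hx
    have h1 : HasDerivAt Z (z' x) x :=
      (hx1 (by rwa [uIcc_of_le hst]) s left_mem_uIcc).const_add (z s)
    have h2 : HasDerivAt (fun x => ‖Z x‖ ^ 2) (2 * inner ℝ (Z x) (z' x)) x := h1.norm_sq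
    have h3 : HasDerivAt (fun x : ℝ => Real.exp (2 * c * (x - s)))
        (Real.exp (2 * c * (x - s)) * (2 * c)) x := by
      have := (((hasDerivAt_id x).sub_const s).const_mul (2 * c)).exp
      simpa using this
    have h4 := (h3.mul h2).deriv
    have e : (fun x => Real.exp (2 * c * (x - s)) * (‖Z x‖ * ‖Z x‖))
        = (fun x : ℝ => Real.exp (2 * c * (x - s))) * fun x => ‖Z x‖ ^ 2 := by
      funext y; simp [sq]
    have h5 := hx2 hx
    rw [hz x hxI, real_inner_comm] at h5
    rw [e, h4]
    have h6 : inner ℝ (Z x) (z' x) ≤ -c * ‖Z x‖ ^ 2 := h5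
    have hp := Real.exp_pos (2 * c * (x - s))
    nlinarith [mul_le_mul_of_nonneg_left h6 hp.le]
  rw [hE.integral_deriv_eq_sub] at hle
  have hs : Z s = z s := by simp [hZ]
  have ht : Z t = z t := (hz t (right_mem_Icc.2 hst)).symm
  rw [hs, ht, sub_self, mul_zero, Real.exp_zero, one_mul] at hle
  have hsq : (Real.exp (c * (t - s)) * ‖z t‖) ^ 2 ≤ ‖z s‖ ^ 2 := by
    rw [mul_pow, ← Real.exp_nat_mul]
    have : ((2 : ℕ) : ℝ) * (c * (t - s)) = 2 * c * (t - s) := by push_cast; ring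
    rw [this, sq, sq]; linarith
  have h := (pow_le_pow_iff_left₀ (by positivity) (norm_nonneg _) two_ne_zero).1 hsq
  calc ‖z t‖ = Real.exp (-c * (t - s)) * (Real.exp (c * (t - s)) * ‖z t‖) := by
        rw [← mul_assoc, ← Real.exp_add]; simp
    _ ≤ _ := by gcongr

end Gronwall

/-! ## Evolution variational inequalities in Hilbert spaces -/

section Abstract

variable {V H G : Type*} [NormedAddCommGroup V] [InnerProductSpace ℝ V]
  [NormedAddCommGroup H] [InnerProductSpace ℝ H]
  [NormedAddCommGroup G] [InnerProductSpace ℝ G]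

/-- `v` solves the variational inequality `⟪h, ι (w - v)⟫ + ⟪D v, D (w - v)⟫ + ℓ (w - v) ≥ 0` for all
`w ∈ K`, with velocity `h`. -/
def SolvesVI (ι : V →L[ℝ] H) (D : V →L[ℝ] G) (ℓ : V →L[ℝ] ℝ) (K : Set V) (h : H) (v : V) : Prop :=
  ∀ w ∈ K, 0 ≤ inner ℝ h (ι (w - v)) + (inner ℝ (D v) (D (w - v)) + ℓ (w - v))

/-- Solutions `u`, with velocity `u'`, of the evolution variational inequality on `(0, ∞)`. -/
structure IsEvolution (ι : V →L[ℝ] H) (D : V →L[ℝ] G) (ℓ : V →L[ℝ] ℝ) (K : Set V)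
    (u : ℝ → V) (u' : ℝ → H) : Prop where
  mem : ∀ t, 0 < t → u t ∈ K
  integrable : ∀ s t, 0 < s → s ≤ t → IntervalIntegrable u' volume s t
  ftc : ∀ s t, 0 < s → s ≤ t → ι (u t) - ι (u s) = ∫ τ in s..t, u' τ
  vi : ∀ᵐ t, 0 < t → SolvesVI ι D ℓ K (u' t) (u t)

variable {ι : V →L[ℝ] H} {D : V →L[ℝ] G} {ℓ : V →L[ℝ] ℝ} {K : Set V}

/-- Each solution is a competitor for the other; in the sum of the two inequalities the linear term
ℓ cancels. -/
theorem SolvesVI.dissipation {h k : H} {v w : V} (hv : SolvesVI ι D ℓ K h v)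
    (hw : SolvesVI ι D ℓ K k w) (hvK : v ∈ K) (hwK : w ∈ K) :
    inner ℝ (h - k) (ι (v - w)) ≤ -‖D (v - w)‖ ^ 2 := by
  have h1 := hv w hwK
  have h2 := hw v hvK
  have e : w - v = -(v - w) := (neg_sub _ _).symm
  rw [e] at h1
  simp only [map_neg, inner_neg_right] at h1
  have h3 : ‖D (v - w)‖ ^ 2 = inner ℝ (D v) (D (v - w)) - inner ℝ (D w) (D (v - w)) := by
    rw [← inner_sub_left, ← map_sub, real_inner_self_eq_norm_sq]
  rw [inner_sub_left]
  linarith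

namespace IsEvolution

/-- Lets `contraction` compare an evolution with an equilibrium. -/
theorem const {v : V} (hv : v ∈ K) (h : SolvesVI ι D ℓ K 0 v) :
    IsEvolution ι D ℓ K (fun _ => v) (fun _ => 0) where
  mem _ _ := hv
  integrable _ _ _ _ := intervalIntegrable_const
  ftc _ _ _ _ := by simp
  vi := Eventually.of_forall fun _ _ => h

/-- The problem is autonomous, so `contraction` also compares u with its translates and thereby
controls difference quotients. -/
theorem shift {u : ℝ → V} {u' : ℝ → H} (hu : IsEvolution ι D ℓ K u u') {h : ℝ} (hh : 0 ≤ h) :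
    IsEvolution ι D ℓ K (fun t => u (t + h)) (fun t => u' (t + h)) where
  mem t ht := hu.mem _ (by linarith)
  integrable s t hs hst := by
    have := (hu.integrable (s + h) (t + h) (by linarith) (by linarith)).comp_add_right h
    simpa using this
  ftc s t hs hst := by
    rw [hu.ftc (s + h) (t + h) (by linarith) (by linarith),
      intervalIntegral.integral_comp_add_right]
  vi := by
    have := (measurePreserving_add_right (volume : Measure ℝ) h).quasiMeasurePreserving.ae hu.vi
    filter_upwards [this] with t ht h0
    exact ht (by linarith)

variable [CompleteSpace H]

theorem contraction {u v : ℝ → V} {u' v' : ℝ → H} {κ : ℝ} (hκ : 0 < κ) (hι : ∀ v, ‖ι v‖ ≤ ‖v‖)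
    (hK : ∀ v ∈ K, ∀ w ∈ K, ‖v - w‖ ≤ κ * ‖D (v - w)‖)
    (hu : IsEvolution ι D ℓ K u u') (hv : IsEvolution ι D ℓ K v v') {s t : ℝ} (hs : 0 < s)
    (hst : s ≤ t) :
    ‖ι (u t - v t)‖ ≤ Real.exp (-(κ ^ 2)⁻¹ * (t - s)) * ‖ι (u s - v s)‖ := by
  refine norm_le_exp_mul_of_inner_deriv_le (z := fun t => ι (u t - v t))
    (z' := fun t => u' t - v' t) hst
    ((hu.integrable s t hs hst).sub (hv.integrable s t hs hst)) (fun x hx => ?_) ?_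
  · rw [intervalIntegral.integral_sub (hu.integrable s x hs hx.1) (hv.integrable s x hs hx.1),
      ← hu.ftc s x hs hx.1, ← hv.ftc s x hs hx.1]
    simp only [map_sub]; abel
  · filter_upwards [hu.vi, hv.vi] with x h1 h2 hx
    have hx0 : 0 < x := hs.trans hx.1
    refine ((h1 hx0).dissipation (h2 hx0) (hu.mem x hx0) (hv.mem x hx0)).trans ?_
    have h3 : ‖ι (u x - v x)‖ ≤ κ * ‖D (u x - v x)‖ :=
      (hι _).trans (hK _ (hu.mem x hx0) _ (hv.mem x hx0))
    have h4 : ‖ι (u x - v x)‖ ^ 2 ≤ κ ^ 2 * ‖D (u x - v x)‖ ^ 2 := by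
      rw [← mul_pow]; gcongr
    rw [neg_mul, neg_le_neg_iff, inv_mul_le_iff₀ (by positivity)]
    exact h4

theorem ae_hasDerivAt {u : ℝ → V} {u' : ℝ → H} (hu : IsEvolution ι D ℓ K u u') :
    ∀ᵐ t, 0 < t → HasDerivAt (fun t => ι (u t)) (u' t) t := by
  -- The velocity is integrable only away from t = 0; these countably many intervals exhaust (0, ∞),
  -- and Lebesgue differentiation applies on each.
  have h : ∀ n : ℕ, ∀ᵐ t : ℝ, t ∈ Ioo (1 / ((n : ℝ) + 1)) (n + 1) →
      HasDerivAt (fun t => ι (u t)) (u' t) t := by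
    intro n
    have h0 : (0 : ℝ) < 1 / ((n : ℝ) + 1) := by positivity
    have h1 : 1 / ((n : ℝ) + 1) ≤ n + 1 := by
      rw [div_le_iff₀ (by positivity)]; nlinarith [(n.cast_nonneg : (0 : ℝ) ≤ n)]
    filter_upwards [(hu.integrable _ _ h0 h1).ae_hasDerivAt_integral] with t ht hmem
    have h2 := (ht (by rw [uIcc_of_le h1]; exact Ioo_subset_Icc_self hmem) _
      left_mem_uIcc).const_add (ι (u (1 / ((n : ℝ) + 1))))
    refine h2.congr_of_eventuallyEq ?_
    filter_upwards [Ioo_mem_nhds hmem.1 hmem.2] with x hx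
    rw [← hu.ftc _ _ h0 hx.1.le]; abel
  filter_upwards [ae_all_iff.2 h] with t ht h0
  obtain ⟨n, hn⟩ := exists_nat_gt (max t (1 / t))
  have hn1 : t < n := (le_max_left _ _).trans_lt hn
  have hn2 : 1 / t < n := (le_max_right _ _).trans_lt hn
  refine ht n ⟨?_, by linarith⟩
  rw [div_lt_iff₀ (by positivity)]
  rw [div_lt_iff₀ h0] at hn2
  linarith

/-- Divide the contraction estimate between u(· + h) and u by h and let h → 0⁺. The starting time s
must be a point of differentiability; taking s < 1 lets the decay cover all t ≥ 1. -/
theorem exists_norm_velocity_le {u : ℝ → V} {u' : ℝ → H} {κ : ℝ} (hκ : 0 < κ)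
    (hι : ∀ v, ‖ι v‖ ≤ ‖v‖) (hK : ∀ v ∈ K, ∀ w ∈ K, ‖v - w‖ ≤ κ * ‖D (v - w)‖)
    (hu : IsEvolution ι D ℓ K u u') :
    ∃ s ∈ Ioo (0 : ℝ) 1, ∀ᵐ t, s < t →
      ‖u' t‖ ≤ Real.exp (-(κ ^ 2)⁻¹ * (t - s)) * ‖u' s‖ := by
  have hne : (ae (volume.restrict (Ioo (0 : ℝ) 1))).NeBot := by
    rw [ae_restrict_neBot]; simp
  obtain ⟨s, hs, hsd⟩ := ((ae_restrict_iff' measurableSet_Ioo).2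
    (hu.ae_hasDerivAt.mono fun t ht (hm : t ∈ Ioo (0 : ℝ) 1) => And.intro hm (ht hm.1))).exists
  refine ⟨s, hs, ?_⟩
  filter_upwards [hu.ae_hasDerivAt] with t ht hst
  have h1 := (ht (hs.1.trans hst)).tendsto_slope_zero_right.norm
  have h2 := (hsd.tendsto_slope_zero_right.norm).const_mul (Real.exp (-(κ ^ 2)⁻¹ * (t - s)))
  refine le_of_tendsto_of_tendsto h1 h2 ?_
  filter_upwards [self_mem_nhdsWithin] with h (hh : 0 < h)
  rw [norm_smul, norm_smul, mul_left_comm, ← map_sub, ← map_sub]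
  gcongr
  exact contraction hκ hι hK (hu.shift hh.le) hu hs.1 hst.le

variable [CompleteSpace V]

/-- Exponential convergence, in the strong norm, of the solutions of the evolution variational
inequality to a stationary solution. -/
theorem exists_norm_sub_le {u : ℝ → V} {u' : ℝ → H} {κ : ℝ} (hκ : 0 < κ)
    (hι : ∀ v, ‖ι v‖ ≤ ‖v‖) (hinj : Function.Injective ι)
    (hK : ∀ v ∈ K, ∀ w ∈ K, ‖v - w‖ ≤ κ * ‖D (v - w)‖)
    (hu : IsEvolution ι D ℓ K u u') (hc : ContinuousOn (fun t => ι (u t)) (Ioi 0)) {φ : V}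
    (hφK : φ ∈ K) (hφ : SolvesVI ι D ℓ K 0 φ) :
    ∃ M > 0, ∀ t, 1 ≤ t → ‖u t - φ‖ ≤ M * Real.exp (-(κ ^ 2)⁻¹ * t) := by
  obtain ⟨s, hs, hvel⟩ := hu.exists_norm_velocity_le hκ hι hK
  set c := (κ ^ 2)⁻¹ with hcdef
  have hc0 : 0 < c := by positivity
  set A := ‖u' s‖ * ‖ι (u s - φ)‖ with hA
  have hA0 : 0 ≤ A := by positivity
  -- The good times: a set of full measure, hence dense.
  set S : Set ℝ := {t | (0 < t → SolvesVI ι D ℓ K (u' t) (u t)) ∧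
    (s < t → ‖u' t‖ ≤ Real.exp (-c * (t - s)) * ‖u' s‖)} with hS
  have hdense : Dense S := Measure.dense_of_ae (hu.vi.and hvel)
  have hgood : ∀ t ∈ S, s < t →
      ‖u t - φ‖ ≤ κ * Real.sqrt A * Real.exp (c * s) * Real.exp (-c * t) := by
    intro t ht hst
    have ht0 := hs.1.trans hst
    have h1 := (ht.1 ht0).dissipation hφ (hu.mem t ht0) hφK
    have h2 : ‖ι (u t - φ)‖ ≤ Real.exp (-c * (t - s)) * ‖ι (u s - φ)‖ :=
      contraction hκ hι hK hu (const hφK hφ) hs.1 hst.le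
    rw [sub_zero] at h1
    -- The velocity and the L² distance each contribute a factor e^{-c(t-s)}, so the square root
    -- keeps the full rate c.
    have h3 : ‖D (u t - φ)‖ ^ 2 ≤ (Real.sqrt A * Real.exp (-c * (t - s))) ^ 2 := by
      have h4 := neg_le_of_abs_le (abs_real_inner_le_norm (u' t) (ι (u t - φ)))
      rw [mul_pow, Real.sq_sqrt hA0]
      calc ‖D (u t - φ)‖ ^ 2 ≤ ‖u' t‖ * ‖ι (u t - φ)‖ := by linarith
        _ ≤ (Real.exp (-c * (t - s)) * ‖u' s‖) * (Real.exp (-c * (t - s)) * ‖ι (u s - φ)‖) := by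
          gcongr
          exact ht.2 hst
        _ = A * Real.exp (-c * (t - s)) ^ 2 := by rw [hA]; ring
    have h5 := (pow_le_pow_iff_left₀ (norm_nonneg _) (by positivity) two_ne_zero).1 h3
    refine (hK _ (hu.mem t ht0) _ hφK).trans ?_
    have e : Real.exp (-c * (t - s)) = Real.exp (c * s) * Real.exp (-c * t) := by
      rw [← Real.exp_add]; ring_nf
    rw [e] at h5
    calc κ * ‖D (u t - φ)‖ ≤ κ * (Real.sqrt A * (Real.exp (c * s) * Real.exp (-c * t))) := by
          gcongr
      _ = _ := by ring
  have hvel1 : ∀ t ∈ S, s < t → ‖u' t‖ ≤ ‖u' s‖ := by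
    intro t ht hst
    refine (ht.2 hst).trans (mul_le_of_le_one_left (norm_nonneg _) ?_)
    rw [Real.exp_le_one_iff]
    nlinarith
  -- With bounded velocities, dissipation between two times of the same curve bounds the squared
  -- strong distance by the weak one: weak continuity becomes strong Cauchyness along good times.
  have hpair : ∀ a ∈ S, s < a → ∀ b ∈ S, s < b →
      ‖u a - u b‖ ^ 2 ≤ κ ^ 2 * (2 * ‖u' s‖) * ‖ι (u a) - ι (u b)‖ := by
    intro a ha hsa b hb hsb
    have ha0 := hs.1.trans hsa
    have hb0 := hs.1.trans hsb
    have h1 := (ha.1 ha0).dissipation (hb.1 hb0) (hu.mem a ha0) (hu.mem b hb0)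
    have h2 := neg_le_of_abs_le (abs_real_inner_le_norm (u' a - u' b) (ι (u a - u b)))
    have h3 : ‖u' a - u' b‖ ≤ 2 * ‖u' s‖ := by
      have := norm_sub_le (u' a) (u' b)
      linarith [hvel1 a ha hsa, hvel1 b hb hsb]
    calc ‖u a - u b‖ ^ 2 ≤ (κ * ‖D (u a - u b)‖) ^ 2 := by
          gcongr; exact hK _ (hu.mem a ha0) _ (hu.mem b hb0)
      _ = κ ^ 2 * ‖D (u a - u b)‖ ^ 2 := by ring
      _ ≤ κ ^ 2 * (‖u' a - u' b‖ * ‖ι (u a - u b)‖) := by gcongr; linarith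
      _ ≤ κ ^ 2 * (2 * ‖u' s‖ * ‖ι (u a - u b)‖) := by gcongr
      _ = _ := by rw [map_sub]; ring
  -- The added 1 keeps the constant positive when A = 0.
  refine ⟨κ * Real.sqrt A * Real.exp (c * s) + 1, by positivity, fun t ht => ?_⟩
  have hst : s < t := hs.2.trans_le ht
  have ht0 : 0 < t := by linarith
  have hcl : t ∈ closure (Ioi s ∩ S) := hdense.open_subset_closure_inter isOpen_Ioi hst
  obtain ⟨τ, hτ, hτt⟩ := mem_closure_iff_seq_limit.1 hcl
  have hlim : Tendsto (fun n => ι (u (τ n))) atTop (𝓝 (ι (u t))) :=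
    ((hc.continuousAt (Ioi_mem_nhds ht0)).tendsto).comp hτt
  have hcau : CauchySeq fun n => u (τ n) := by
    rw [Metric.cauchySeq_iff']
    intro ε hε
    have hB : 0 < κ ^ 2 * (2 * ‖u' s‖) + 1 := by positivity
    obtain ⟨N, hN⟩ := Metric.cauchySeq_iff'.1 hlim.cauchySeq
      (ε ^ 2 / (κ ^ 2 * (2 * ‖u' s‖) + 1)) (by positivity)
    refine ⟨N, fun n hn => ?_⟩
    have h1 := hpair _ (hτ n).2 (hτ n).1 _ (hτ N).2 (hτ N).1
    have h2 := hN n hn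
    rw [dist_eq_norm] at h2 ⊢
    rw [lt_div_iff₀ hB] at h2
    refine lt_of_pow_lt_pow_left₀ 2 hε.le (lt_of_le_of_lt h1 ?_)
    nlinarith [norm_nonneg (ι (u (τ n)) - ι (u (τ N)))]
  obtain ⟨v, hv⟩ := cauchySeq_tendsto_of_complete hcau
  -- Continuity in H identifies the image of the strong limit, and injectivity of ι the limit
  -- itself.
  have hvt : v = u t := hinj (tendsto_nhds_unique ((ι.continuous.tendsto v).comp hv) hlim)
  rw [hvt] at hv
  have hb : ‖u t - φ‖ ≤ κ * Real.sqrt A * Real.exp (c * s) * Real.exp (-c * t) := by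
    refine le_of_tendsto_of_tendsto (hv.sub_const φ).norm ?_
      (Eventually.of_forall fun n => hgood _ (hτ n).2 (hτ n).1)
    exact ((Continuous.tendsto (by fun_prop) t).comp hτt :
      Tendsto ((fun x => κ * Real.sqrt A * Real.exp (c * s) * Real.exp (-c * x)) ∘ τ) atTop _)
  refine hb.trans ?_
  gcongr
  linarith

end IsEvolution

end Abstract

/-! ## Minimizers of quadratic energies on closed convex sets -/

section Minimizer

variable {V H G : Type*} [NormedAddCommGroup V] [InnerProductSpace ℝ V]
  [NormedAddCommGroup H] [InnerProductSpace ℝ H]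
  [NormedAddCommGroup G] [InnerProductSpace ℝ G]

/-- The energy `½ ‖D v‖² + ℓ v`. -/
noncomputable def quadEnergy (D : V →L[ℝ] G) (ℓ : V →L[ℝ] ℝ) (v : V) : ℝ :=
  1 / 2 * ‖D v‖ ^ 2 + ℓ v

variable {ι : V →L[ℝ] H} {D : V →L[ℝ] G} {ℓ : V →L[ℝ] ℝ} {K : Set V}

theorem quadEnergy_add_smul (v w : V) (s : ℝ) :
    quadEnergy D ℓ (v + s • w)
      = quadEnergy D ℓ v + s * (inner ℝ (D v) (D w) + ℓ w) + s ^ 2 / 2 * ‖D w‖ ^ 2 := by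
  simp only [quadEnergy, map_add, map_smul, smul_eq_mul]
  rw [norm_add_sq_real, norm_smul, inner_smul_right, mul_pow, Real.norm_eq_abs, sq_abs]
  ring

theorem quadEnergy_zero (D : V →L[ℝ] G) (v : V) : quadEnergy D 0 v = 1 / 2 * ‖D v‖ ^ 2 := by
  simp [quadEnergy]

/-- The parallelogram law: the quantitative convexity behind existence and uniqueness. -/
theorem quadEnergy_midpoint (v w : V) :
    quadEnergy D ℓ ((1 / 2 : ℝ) • v + (1 / 2 : ℝ) • w)
      = (quadEnergy D ℓ v + quadEnergy D ℓ w) / 2 - 1 / 8 * ‖D (v - w)‖ ^ 2 := by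
  have e1 : (1 / 2 : ℝ) • v + (1 / 2 : ℝ) • w = w + (1 / 2 : ℝ) • (v - w) := by module
  have h1 := quadEnergy_add_smul (D := D) (ℓ := ℓ) w (v - w) 1
  rw [one_smul, add_sub_cancel] at h1
  rw [e1, quadEnergy_add_smul]
  linarith

/-- Compare φ with φ + s(w - φ) ∈ K, divide by s and let s → 0⁺. -/
theorem solvesVI_zero_of_minimizer (hconv : Convex ℝ K) {φ : V} (hφ : φ ∈ K)
    (hmin : ∀ v ∈ K, quadEnergy D ℓ φ ≤ quadEnergy D ℓ v) : SolvesVI ι D ℓ K 0 φ := by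
  intro w hw
  rw [inner_zero_left, zero_add]
  have h : ∀ s ∈ Ioc (0 : ℝ) 1,
      0 ≤ (inner ℝ (D φ) (D (w - φ)) + ℓ (w - φ)) + s / 2 * ‖D (w - φ)‖ ^ 2 := by
    intro s hs
    have h1 := hmin _ (hconv.add_smul_sub_mem hφ hw ⟨hs.1.le, hs.2⟩)
    rw [quadEnergy_add_smul] at h1
    have h2 : 0 ≤ s * ((inner ℝ (D φ) (D (w - φ)) + ℓ (w - φ)) + s / 2 * ‖D (w - φ)‖ ^ 2) := by
      linarith
    exact (mul_nonneg_iff_of_pos_left hs.1).1 h2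
  have hlim : Tendsto (fun s : ℝ =>
      (inner ℝ (D φ) (D (w - φ)) + ℓ (w - φ)) + s / 2 * ‖D (w - φ)‖ ^ 2) (𝓝[>] 0)
      (𝓝 ((inner ℝ (D φ) (D (w - φ)) + ℓ (w - φ)) + 0 / 2 * ‖D (w - φ)‖ ^ 2)) :=
    (Continuous.tendsto (by fun_prop) 0).mono_left nhdsWithin_le_nhds
  rw [zero_div, zero_mul, add_zero] at hlim
  refine ge_of_tendsto hlim ?_
  filter_upwards [Ioc_mem_nhdsGT (zero_lt_one (α := ℝ))] with s hs using h s hs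

theorem bddBelow_quadEnergy {κ : ℝ} (hK : ∀ v ∈ K, ∀ w ∈ K, ‖v - w‖ ≤ κ * ‖D (v - w)‖) :
    BddBelow (quadEnergy D ℓ '' K) := by
  rcases K.eq_empty_or_nonempty with rfl | ⟨v, hv⟩
  · simp
  -- With r = ‖D(w - v)‖ and a = ‖D v‖ + ‖ℓ‖κ, the energy changes by at least r²/2 - a r, whose
  -- minimum is -a²/2.
  refine ⟨quadEnergy D ℓ v - (‖D v‖ + ‖ℓ‖ * κ) ^ 2 / 2, ?_⟩
  rintro _ ⟨w, hw, rfl⟩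
  have h1 := quadEnergy_add_smul (D := D) (ℓ := ℓ) v (w - v) 1
  rw [one_smul, add_sub_cancel] at h1
  have h2 := neg_le_of_abs_le (abs_real_inner_le_norm (D v) (D (w - v)))
  have h3 := neg_le_of_abs_le (ℓ.le_opNorm (w - v))
  have h4 : ‖ℓ‖ * ‖w - v‖ ≤ ‖ℓ‖ * (κ * ‖D (w - v)‖) := by gcongr; exact hK w hw v hv
  nlinarith [sq_nonneg (‖D (w - v)‖ - (‖D v‖ + ‖ℓ‖ * κ))]

theorem existsUnique_minimizer [CompleteSpace V] {κ : ℝ} (hκ : 0 < κ)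
    (hK : ∀ v ∈ K, ∀ w ∈ K, ‖v - w‖ ≤ κ * ‖D (v - w)‖) (hne : K.Nonempty) (hcl : IsClosed K)
    (hconv : Convex ℝ K) :
    ∃! φ, φ ∈ K ∧ ∀ v ∈ K, quadEnergy D ℓ φ ≤ quadEnergy D ℓ v := by
  have hbdd := bddBelow_quadEnergy (ℓ := ℓ) hK
  set I := sInf (quadEnergy D ℓ '' K) with hI
  have hle : ∀ v ∈ K, I ≤ quadEnergy D ℓ v := fun v hv => csInf_le hbdd (mem_image_of_mem _ hv)
  -- The midpoint has energy at least I, so the defect ‖D(v - w)‖²/8 is at most δ. Small δ gives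
  -- Cauchy sequences; δ = 0 gives uniqueness.
  have hpair : ∀ v ∈ K, ∀ w ∈ K, ∀ δ : ℝ, quadEnergy D ℓ v ≤ I + δ → quadEnergy D ℓ w ≤ I + δ →
      ‖v - w‖ ≤ κ * Real.sqrt (8 * δ) := by
    intro v hv w hw δ h1 h2
    have h3 := hle _ (hconv hv hw (by norm_num : (0 : ℝ) ≤ 1 / 2) (by norm_num : (0 : ℝ) ≤ 1 / 2)
      (by norm_num))
    rw [quadEnergy_midpoint] at h3
    refine (hK v hv w hw).trans ?_
    gcongr
    exact Real.le_sqrt_of_sq_le (by linarith)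
  have hex : ∀ n : ℕ, ∃ v ∈ K, quadEnergy D ℓ v < I + 1 / ((n : ℝ) + 1) := by
    intro n
    obtain ⟨_, ⟨v, hv, rfl⟩, h⟩ := Real.lt_sInf_add_pos (hne.image (quadEnergy D ℓ))
      (show (0 : ℝ) < 1 / ((n : ℝ) + 1) by positivity)
    exact ⟨v, hv, h⟩
  choose x hxK hx using hex
  have hcau : CauchySeq x := by
    refine cauchySeq_of_le_tendsto_0 (fun N : ℕ => κ * Real.sqrt (8 * (1 / ((N : ℝ) + 1)))) ?_ ?_
    · intro n m N hn hm
      rw [dist_eq_norm]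
      refine hpair _ (hxK n) _ (hxK m) _ ((hx n).le.trans ?_) ((hx m).le.trans ?_)
      · gcongr
      · gcongr
    · have h := ((tendsto_one_div_add_atTop_nhds_zero_nat (𝕜 := ℝ)).const_mul 8).sqrt.const_mul κ
      simpa using h
  obtain ⟨φ, hφ⟩ := cauchySeq_tendsto_of_complete hcau
  have hφK : φ ∈ K := hcl.mem_of_tendsto hφ (Eventually.of_forall hxK)
  have hcont : Continuous (quadEnergy D ℓ) := by unfold quadEnergy; fun_prop
  have hφI : quadEnergy D ℓ φ ≤ I := by
    refine le_of_tendsto_of_tendsto' ((hcont.tendsto φ).comp hφ)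
      (?_ : Tendsto (fun n : ℕ => I + 1 / ((n : ℝ) + 1)) atTop (𝓝 I)) fun n => (hx n).le
    simpa using (tendsto_one_div_add_atTop_nhds_zero_nat (𝕜 := ℝ)).const_add I
  refine ⟨φ, ⟨hφK, fun v hv => hφI.trans (hle v hv)⟩, fun ψ hψ => ?_⟩
  have h := hpair ψ hψ.1 φ hφK 0 (by linarith [hψ.2 φ hφK]) (by linarith)
  rw [mul_zero, Real.sqrt_zero, mul_zero] at h
  exact sub_eq_zero.1 (norm_le_zero_iff.1 h)

/-- The exceptional null set may depend on the competitor. A countable dense subset of K yields a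
common one, and continuity in w recovers all of K. -/
theorem ae_solvesVI [SecondCountableTopology V] {α : Type*} [MeasurableSpace α] {μ : Measure α}
    {u : α → V} {u' : α → H}
    (h : ∀ w ∈ K, ∀ᵐ t ∂μ, 0 ≤ inner ℝ (u' t) (ι (w - u t))
      + (inner ℝ (D (u t)) (D (w - u t)) + ℓ (w - u t))) :
    ∀ᵐ t ∂μ, SolvesVI ι D ℓ K (u' t) (u t) := by
  obtain ⟨S, hSc, hSd⟩ := TopologicalSpace.exists_countable_dense K
  have h1 : ∀ᵐ t ∂μ, ∀ w ∈ S, 0 ≤ inner ℝ (u' t) (ι ((w : V) - u t))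
      + (inner ℝ (D (u t)) (D ((w : V) - u t)) + ℓ ((w : V) - u t)) :=
    (ae_ball_iff hSc).2 fun w _ => h w w.2
  filter_upwards [h1] with t ht w hw
  have hc : IsClosed {w : K | 0 ≤ inner ℝ (u' t) (ι ((w : V) - u t))
      + (inner ℝ (D (u t)) (D ((w : V) - u t)) + ℓ ((w : V) - u t))} :=
    isClosed_le continuous_const (by fun_prop)
  exact closure_minimal ht hc (hSd ⟨w, hw⟩)

end Minimizer

/-! ## Convex sets -/

theorem convex_sub_mem {V : Type*} [AddCommGroup V] [Module ℝ V] (S : Submodule ℝ V) (g : V) :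
    Convex ℝ {u | u - g ∈ S} := by
  intro u hu v hv a b _ _ hab
  have e : a • u + b • v - g = a • (u - g) + b • (v - g) := by
    rw [smul_sub, smul_sub, sub_add_sub_comm, ← add_smul, hab, one_smul]
  rw [mem_ofPred_eq, e]
  exact S.add_mem (S.smul_mem a hu) (S.smul_mem b hv)

theorem convex_setOf_forall_nonneg {V ι : Type*} [NormedAddCommGroup V] [NormedSpace ℝ V]
    (T : ι → V →L[ℝ] ℝ) : Convex ℝ {u | ∀ i, 0 ≤ T i u} := by
  intro u hu v hv a b ha hb _ i
  have h1 := hu i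
  have h2 := hv i
  rw [map_add, map_smul, map_smul, smul_eq_mul, smul_eq_mul]
  positivity

theorem isClosed_setOf_forall_nonneg {V ι : Type*} [NormedAddCommGroup V] [NormedSpace ℝ V]
    (T : ι → V →L[ℝ] ℝ) : IsClosed {u | ∀ i, 0 ≤ T i u} := by
  rw [ofPred_forall]
  exact isClosed_iInter fun i => isClosed_le continuous_const (T i).continuous

namespace ObstacleFlow

/-! ## `H¹(Ω)` as a Hilbert space -/

section Sobolev

variable {d : ℕ} {Ω : Set (E d)}

/-- Written as an inner product, the integral is visibly continuous in u. -/
theorem integral_mul_eq_inner {f : E d → ℝ} (hf : MemLp f 2 (volume.restrict Ω)) (u : L2 Ω) :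
    ∫ x in Ω, u x * f x = inner ℝ (hf.toLp f) u := by
  rw [L2.inner_def]
  refine integral_congr_ae ?_
  filter_upwards [hf.coeFn_toLp] with x hx
  rw [hx]
  simp

theorem integral_inner_mul_eq_inner {f : E d → ℝ} (hf : MemLp f 2 (volume.restrict Ω)) (e : E d)
    (G : L2V Ω) :
    ∫ x in Ω, inner ℝ (G x) e * f x
      = inner ℝ ((ContinuousLinearMap.toSpanSingleton ℝ e).compLp (hf.toLp f)) G := by
  rw [L2.inner_def]
  refine integral_congr_ae ?_
  filter_upwards [hf.coeFn_toLp,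
    (ContinuousLinearMap.toSpanSingleton ℝ e).coeFn_compLp (hf.toLp f)] with x hx hx'
  rw [hx', hx, ContinuousLinearMap.toSpanSingleton_apply, real_inner_smul_left,
    real_inner_comm, mul_comm]

theorem isClosed_H1 : IsClosed (H1 Ω : Set (WithLp 2 (L2 Ω × L2V Ω))) := by
  have : (H1 Ω : Set (WithLp 2 (L2 Ω × L2V Ω))) = ⋂ (ψ : E d → ℝ) (_ : IsTest Ω ψ) (e : E d),
      {p | ∫ x in Ω, p.fst x * fderiv ℝ ψ x e = -∫ x in Ω, inner ℝ (p.snd x) e * ψ x} := by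
    ext p
    simp only [mem_iInter]
    rfl
  rw [this]
  refine isClosed_iInter fun ψ => isClosed_iInter fun hψ => isClosed_iInter fun e => ?_
  simp_rw [integral_mul_eq_inner (hψ.memLp_fderiv e), integral_inner_mul_eq_inner hψ.memLp e]
  exact isClosed_eq (by fun_prop) (by fun_prop)

instance : CompleteSpace (H1 Ω) := isClosed_H1.completeSpace_coe

instance : SecondCountableTopology (H1 Ω) := by
  have : Fact ((2 : ENNReal) ≠ ⊤) := ⟨by norm_num⟩
  have h1 : SecondCountableTopology (L2 Ω) := inferInstance
  have h2 : SecondCountableTopology (L2V Ω) := inferInstance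
  have h3 : SecondCountableTopology (WithLp 2 (L2 Ω × L2V Ω)) :=
    WithLp.secondCountableTopology _ _ _
  exact TopologicalSpace.Subtype.secondCountableTopology _

/-- The inclusion of `H¹(Ω)` in `L²(Ω)`, as a continuous linear map. -/
noncomputable def fnL (Ω : Set (E d)) : H1 Ω →L[ℝ] L2 Ω :=
  (WithLp.fstL 2 ℝ (L2 Ω) (L2V Ω)).comp (H1 Ω).subtypeL

/-- The weak gradient, as a continuous linear map on `H¹(Ω)`. -/
noncomputable def gradL (Ω : Set (E d)) : H1 Ω →L[ℝ] L2V Ω :=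
  (WithLp.sndL 2 ℝ (L2 Ω) (L2V Ω)).comp (H1 Ω).subtypeL

@[simp] theorem fnL_apply (u : H1 Ω) : fnL Ω u = fn u := rfl

@[simp] theorem gradL_apply (u : H1 Ω) : gradL Ω u = grad u := rfl

@[fun_prop] theorem continuous_fn : Continuous (fn : H1 Ω → L2 Ω) := (fnL Ω).continuous

@[fun_prop] theorem continuous_grad : Continuous (grad : H1 Ω → L2V Ω) := (gradL Ω).continuous

theorem norm_sq_H1 (u : H1 Ω) : ‖u‖ ^ 2 = ‖fn u‖ ^ 2 + ‖grad u‖ ^ 2 :=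
  WithLp.prod_norm_sq_eq_of_L2 (u : WithLp 2 (L2 Ω × L2V Ω))

theorem norm_fn_le (u : H1 Ω) : ‖fn u‖ ≤ ‖u‖ := by
  refine (pow_le_pow_iff_left₀ (norm_nonneg _) (norm_nonneg _) two_ne_zero).1 ?_
  rw [norm_sq_H1]
  exact le_add_of_nonneg_right (sq_nonneg _)

theorem integral_norm_sq_grad (u : H1 Ω) : ∫ x in Ω, ‖grad u x‖ ^ 2 = ‖grad u‖ ^ 2 := by
  rw [← real_inner_self_eq_norm_sq (grad u), L2.inner_def]
  simp only [real_inner_self_eq_norm_sq]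

theorem integral_sq_fn (u : H1 Ω) : ∫ x in Ω, fn u x ^ 2 = ‖fn u‖ ^ 2 := by
  rw [← real_inner_self_eq_norm_sq (fn u), L2.inner_def]
  simp only [real_inner_self_eq_norm_sq, Real.norm_eq_abs, sq_abs]

/-- The continuous linear functional `u ↦ ∫_Ω (u f + ⟪∇u, e⟫ h)` on `H¹(Ω)`. -/
noncomputable def pairingL {f h : E d → ℝ} (hf : MemLp f 2 (volume.restrict Ω))
    (hh : MemLp h 2 (volume.restrict Ω)) (e : E d) : H1 Ω →L[ℝ] ℝ :=
  (innerSL ℝ (hf.toLp f)).comp (fnL Ω) + (innerSL ℝ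
    ((ContinuousLinearMap.toSpanSingleton ℝ e).compLp (hh.toLp h))).comp (gradL Ω)

theorem pairingL_apply {f h : E d → ℝ} (hf : MemLp f 2 (volume.restrict Ω))
    (hh : MemLp h 2 (volume.restrict Ω)) (e : E d) (u : H1 Ω) :
    pairingL hf hh e u = ∫ x in Ω, (fn u x * f x + inner ℝ (grad u x) e * h x) := by
  rw [pairingL, _root_.add_apply, ContinuousLinearMap.comp_apply,
    ContinuousLinearMap.comp_apply, innerSL_apply_apply, innerSL_apply_apply, fnL_apply,
    gradL_apply, ← integral_mul_eq_inner, ← integral_inner_mul_eq_inner]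
  exact (integral_add ((Lp.memLp (fn u)).integrable_mul hf)
    (((Lp.memLp (grad u)).inner_const e).integrable_mul hh)).symm

/-- The weak gradient is determined by the function. -/
theorem fn_injective (hΩ : IsOpen Ω) : Function.Injective (fnL Ω) := by
  rw [injective_iff_map_eq_zero]
  intro w hw
  rw [fnL_apply] at hw
  have hgrad : grad w = 0 := by
    have hint : ∀ e : E d, LocallyIntegrable (fun x => inner ℝ (grad w x) e)
        (volume.restrict Ω) := fun e => ((Lp.memLp (grad w)).inner_const e).locallyIntegrable
          (by norm_num)
    have hz : ∀ i : Fin d, ∀ᵐ x ∂(volume.restrict Ω),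
        x ∈ Ω → inner ℝ (grad w x) (EuclideanSpace.single i (1 : ℝ)) = 0 := by
      intro i
      -- The fundamental lemma of the calculus of variations, applied to each component of the
      -- gradient.
      refine hΩ.ae_eq_zero_of_integral_contDiff_smul_eq_zero
        ((hint _).locallyIntegrableOn Ω) fun ψ h1 h2 h3 => ?_
      have hψ : IsTest Ω ψ := ⟨h1, h2, h3⟩
      have h := w.2 ψ hψ (EuclideanSpace.single i (1 : ℝ))
      change ∫ x in Ω, fn w x * fderiv ℝ ψ x _ = -∫ x in Ω, inner ℝ (grad w x) _ * ψ x at h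
      rw [integral_mul_eq_inner (hψ.memLp_fderiv _), hw, inner_zero_right] at h
      simp_rw [smul_eq_mul, mul_comm (ψ _)]
      linarith
    refine Lp.ext ?_
    filter_upwards [ae_all_iff.2 hz, ae_restrict_mem hΩ.measurableSet,
      Lp.coeFn_zero (E d) 2 (volume.restrict Ω)] with x hx hxΩ h0
    rw [h0]
    ext i
    have := hx i hxΩ
    rw [EuclideanSpace.inner_single_right] at this
    simpa using this
  have h := norm_sq_H1 w
  rw [hw, hgrad, norm_zero, norm_zero] at h
  simpa using h

/-! ## `H¹₀(Ω)` and the Poincaré inequality in the unit ball -/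

/-- The subspace of the elements of `H¹(Ω)` represented by functions in `C_c^∞(Ω)`. -/
def testSubmodule (Ω : Set (E d)) : Submodule ℝ (H1 Ω) where
  carrier := {w | ∃ ψ : E d → ℝ, IsTest Ω ψ ∧ fn w =ᵐ[volume.restrict Ω] ψ ∧
    grad w =ᵐ[volume.restrict Ω] fun x => gradient ψ x}
  zero_mem' := by
    refine ⟨0, ⟨contDiff_const, HasCompactSupport.zero, by simp⟩,
      Lp.coeFn_zero ℝ 2 (volume.restrict Ω), ?_⟩
    filter_upwards [Lp.coeFn_zero (E d) 2 (volume.restrict Ω)] with x hx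
    refine hx.trans ?_
    simp [gradient]
  add_mem' := by
    rintro v w ⟨ψ, hψ, h1, h2⟩ ⟨χ, hχ, h3, h4⟩
    refine ⟨ψ + χ, ⟨hψ.smooth.add hχ.smooth, hψ.compact.add hχ.compact,
      (tsupport_add ψ χ).trans (union_subset hψ.supp hχ.supp)⟩, ?_, ?_⟩
    · exact (Lp.coeFn_add (fn v) (fn w)).trans (h1.add h3)
    · refine (Lp.coeFn_add (grad v) (grad w)).trans ((h2.add h4).trans (ae_of_all _ fun x => ?_))
      simp only [gradient]
      rw [fderiv_add (hψ.smooth.differentiable (by simp) x)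
        (hχ.smooth.differentiable (by simp) x), map_add]
      rfl
  smul_mem' := by
    rintro c w ⟨ψ, hψ, h1, h2⟩
    refine ⟨c • ψ, ⟨contDiff_const.smul hψ.smooth, hψ.compact.smul_left (f := fun _ => c),
      (closure_mono (Function.support_const_smul_subset c ψ)).trans hψ.supp⟩, ?_, ?_⟩
    · exact (Lp.coeFn_smul c (fn w)).trans (h1.const_smul c)
    · refine (Lp.coeFn_smul c (grad w)).trans ((h2.const_smul c).trans (ae_of_all _ fun x => ?_))
      simp only [gradient]
      rw [fderiv_const_smul (hψ.smooth.differentiable (by simp) x), map_smul]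
      rfl

end Sobolev

theorem IsTest.coord_mul {d : ℕ} {Ω : Set (E d)} {ψ : E d → ℝ} (h : IsTest Ω ψ) (i : Fin d) :
    IsTest Ω fun x => x i * ψ x where
  smooth := ContDiff.mul (by fun_prop) h.smooth
  compact := h.compact.mul_left (f := fun x : E d => x i)
  supp := (tsupport_mul_subset_right (f := fun x : E d => x i)).trans h.supp

theorem IsTest.fderiv_coord_mul {d : ℕ} {Ω : Set (E d)} {ψ : E d → ℝ} (h : IsTest Ω ψ) (i : Fin d)
    (x : E d) : fderiv ℝ (fun x => x i * ψ x) x (EuclideanSpace.single i 1)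
      = ψ x + x i * fderiv ℝ ψ x (EuclideanSpace.single i 1) := by
  have h1 : HasFDerivAt (fun x : E d => x i) (EuclideanSpace.proj i : E d →L[ℝ] ℝ) x :=
    (EuclideanSpace.proj i : E d →L[ℝ] ℝ).hasFDerivAt
  have h2 := (h.smooth.differentiable (by simp) x).hasFDerivAt
  rw [HasFDerivAt.fderiv (f := fun x : E d => x i * ψ x) (h1.mul h2)]
  simp
  ring

/-- Testing the weak gradient of w with x₀ψ, where w = ψ, gives ∫ (ψ² + 2x₀ψ∂₀ψ) = 0. Since |x₀| ≤ 1
in the ball, Young's inequality yields ½‖ψ‖² ≤ 2‖∇ψ‖². -/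
theorem norm_fn_le_of_test {n : ℕ} {w : H1 (ball1 (n + 1))}
    (hw : w ∈ testSubmodule (ball1 (n + 1))) : ‖fn w‖ ≤ 2 * ‖grad w‖ := by
  obtain ⟨ψ, hψ, h1, h2⟩ := hw
  set e : E (n + 1) := EuclideanSpace.single 0 1 with he
  have h := w.2 _ (hψ.coord_mul 0) e
  change ∫ x in ball1 (n + 1), fn w x * fderiv ℝ _ x e
    = -∫ x in ball1 (n + 1), inner ℝ (grad w x) e * (x 0 * ψ x) at h
  have hi1 := (hψ.coord_mul 0).integrable_left (fn w) e
  have hi2 := (hψ.coord_mul 0).integrable_right (grad w) e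
  have hsum : ∫ x in ball1 (n + 1), (fn w x * fderiv ℝ (fun x => x 0 * ψ x) x e
      + inner ℝ (grad w x) e * (x 0 * ψ x)) = 0 := by
    rw [integral_add hi1 hi2, h, neg_add_cancel]
  have hw2 : Integrable (fun x => fn w x ^ 2) (volume.restrict (ball1 (n + 1))) :=
    (Lp.memLp (fn w)).integrable_sq
  have hg2 : Integrable (fun x => ‖grad w x‖ ^ 2) (volume.restrict (ball1 (n + 1))) :=
    (Lp.memLp (grad w)).norm.integrable_sq
  have hle : ∫ x in ball1 (n + 1), (1 / 2 * fn w x ^ 2 - 2 * ‖grad w x‖ ^ 2) ≤ 0 := by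
    rw [← hsum]
    refine integral_mono_ae ((hw2.const_mul _).sub (hg2.const_mul _)) (hi1.add hi2) ?_
    filter_upwards [h1, h2, ae_restrict_mem Metric.isOpen_ball.measurableSet] with x hx1 hx2 hx
    have hx0 : |x 0| ≤ 1 := by
      have := PiLp.norm_apply_le x 0
      rw [Real.norm_eq_abs] at this
      exact this.trans (mem_ball_zero_iff.1 hx).le
    have hgr : inner ℝ (grad w x) e = fderiv ℝ ψ x e := by
      rw [hx2]
      exact InnerProductSpace.toDual_symm_apply
    have hge : |inner ℝ (grad w x) e| ≤ ‖grad w x‖ := by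
      refine (abs_real_inner_le_norm _ _).trans ?_
      simp [he]
    rw [hψ.fderiv_coord_mul, ← he, ← hgr, ← hx1]
    set a := fn w x
    set b := inner ℝ (grad w x) e
    have h3 : |2 * (x 0 * (a * b))| ≤ 2 * (|a| * ‖grad w x‖) := by
      rw [abs_mul, abs_mul, abs_mul, abs_two]
      have : |x 0| * (|a| * |b|) ≤ 1 * (|a| * ‖grad w x‖) := by gcongr
      linarith
    have h4 := neg_le_of_abs_le h3
    have h5 : a ^ 2 = |a| ^ 2 := (sq_abs a).symm
    nlinarith [sq_nonneg (|a| - 2 * ‖grad w x‖)]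
  rw [integral_sub (hw2.const_mul _) (hg2.const_mul _), integral_const_mul, integral_const_mul,
    integral_sq_fn, integral_norm_sq_grad] at hle
  refine (pow_le_pow_iff_left₀ (norm_nonneg _) (by positivity) two_ne_zero).1 ?_
  rw [mul_pow]
  linarith

theorem norm_le_of_mem_H10 {n : ℕ} {w : H1 (ball1 (n + 1))} (hw : w ∈ H10 (ball1 (n + 1))) :
    ‖w‖ ≤ 3 * ‖grad w‖ := by
  have hcl : IsClosed {w : H1 (ball1 (n + 1)) | ‖fn w‖ ≤ 2 * ‖grad w‖} :=
    isClosed_le (by fun_prop) (by fun_prop)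
  have h : ‖fn w‖ ≤ 2 * ‖grad w‖ :=
    closure_minimal (s := (testSubmodule (ball1 (n + 1)) : Set (H1 (ball1 (n + 1)))))
      (fun v hv => norm_fn_le_of_test hv) hcl hw
  -- The squared H¹ norm is at most (4 + 1)‖∇w‖² ≤ 9‖∇w‖².
  refine (pow_le_pow_iff_left₀ (norm_nonneg _) (by positivity) two_ne_zero).1 ?_
  rw [norm_sq_H1]
  nlinarith [norm_nonneg (fn w), norm_nonneg (grad w)]

/-! ## Minimizers and strong solutions of quadratic problems -/

section General

variable {d : ℕ} {Ω Ω' : Set (E d)} {F : H1 Ω → ℝ} {ℓ : H1 Ω →L[ℝ] ℝ} {K : Set (H1 Ω)}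

/-- By definition `H10` is the closure of `testSubmodule`, hence a linear subspace. -/
theorem sub_mem_H10 {g v w : H1 Ω} (hv : v - g ∈ H10 Ω) (hw : w - g ∈ H10 Ω) :
    v - w ∈ H10 Ω := by
  have h := (testSubmodule Ω).topologicalClosure.sub_mem hv hw
  rwa [sub_sub_sub_cancel_right] at h

theorem firstVariation_eq (hF : F = quadEnergy (gradL Ω) ℓ) (u w : H1 Ω) :
    firstVariation F u w = inner ℝ (grad u) (grad w) + ℓ w := by
  have h : ∀ a b c : ℝ, HasDerivAt (fun s : ℝ => a + s * b + s ^ 2 / 2 * c) b 0 := by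
    intro a b c
    have := (((hasDerivAt_id (0 : ℝ)).mul_const b).const_add a).add
      ((((hasDerivAt_id (0 : ℝ)).pow 2).div_const 2).mul_const c)
    exact this.congr_deriv (by simp)
  have e := funext fun s : ℝ => quadEnergy_add_smul (D := gradL Ω) (ℓ := ℓ) u w s
  rw [firstVariation, hF, e]
  exact (h _ _ _).deriv

theorem IsStrongSolution.isEvolution (hF : F = quadEnergy (gradL Ω) ℓ) {u : ℝ → H1 Ω}
    (hu : IsStrongSolution F K Ω' u) :
    ∃ u' : ℝ → L2 Ω, IsEvolution (fnL Ω) (gradL Ω) ℓ K u u' := by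
  obtain ⟨u', ⟨hL2, hftc⟩, hvi⟩ := hu.inequality
  refine ⟨u', fun t ht => hu.mem t ht.le, fun s t hs hst => ?_, hftc, ?_⟩
  · have hm := (hL2 s t hs hst).integrable (by norm_num)
    exact (intervalIntegrable_iff_integrableOn_Icc_of_le hst).2 hm
  · refine (ae_restrict_iff' measurableSet_Ioi).1 (ae_solvesVI fun w hw => ?_)
    filter_upwards [hvi w hw] with t ht
    rwa [firstVariation_eq hF] at ht

/-- Well-posedness of the stationary problem and exponential convergence to equilibrium of the
strong solutions, for quadratic energies which are coercive on `K`. -/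
theorem stationary_and_convergence (hΩ : IsOpen Ω) (hF : F = quadEnergy (gradL Ω) ℓ) {κ : ℝ}
    (hκ : 0 < κ) (hP : ∀ w ∈ H10 Ω, ‖w‖ ≤ κ * ‖grad w‖) {g : H1 Ω} (hg : g ∈ K)
    (hKg : K ⊆ {u | u - g ∈ H10 Ω}) (hcl : IsClosed K) (hconv : Convex ℝ K) :
    (∃! φ, IsMinimizer F K φ) ∧
      ∀ (φ : H1 Ω) (u : ℝ → H1 Ω), IsMinimizer F K φ → IsStrongSolution F K Ω' u →
        Tendsto u atTop (𝓝 φ) ∧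
        ∃ C > 0, ∃ M > 0, ∀ t : ℝ, 1 ≤ t → ‖u t - φ‖ ≤ M * Real.exp (-C * t) := by
  have hK : ∀ v ∈ K, ∀ w ∈ K, ‖v - w‖ ≤ κ * ‖grad (v - w)‖ := fun v hv w hw =>
    hP _ (sub_mem_H10 (hKg hv) (hKg hw))
  have hne : K.Nonempty := ⟨g, hg⟩
  refine ⟨?_, fun φ u hφ hu => ?_⟩
  · rw [hF]
    exact existsUnique_minimizer (D := gradL Ω) (ℓ := ℓ) hκ hK hne hcl hconv
  obtain ⟨u', hev⟩ := hu.isEvolution hF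
  rw [hF] at hφ
  obtain ⟨M, hM, hb⟩ := hev.exists_norm_sub_le hκ norm_fn_le (fn_injective hΩ) hK
    (hu.continuousOn.mono Ioi_subset_Ici_self) hφ.1 (solvesVI_zero_of_minimizer hconv hφ.1 hφ.2)
  have hC : 0 < (κ ^ 2)⁻¹ := by positivity
  refine ⟨?_, _, hC, M, hM, hb⟩
  rw [tendsto_iff_norm_sub_tendsto_zero]
  have hexp : Tendsto (fun t : ℝ => M * Real.exp (-(κ ^ 2)⁻¹ * t)) atTop (𝓝 0) := by
    have h := (Real.tendsto_exp_neg_atTop_nhds_zero.comp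
      (tendsto_id.const_mul_atTop hC)).const_mul M
    simpa [Function.comp_def] using h
  refine squeeze_zero' (Eventually.of_forall fun t => norm_nonneg _) ?_ hexp
  filter_upwards [eventually_ge_atTop (1 : ℝ)] with t ht using hb t ht

end General

/-! ## The admissible sets -/

section Affine

variable {d : ℕ} {Ω : Set (E d)}

theorem convex_sub_mem_H10 (g : H1 Ω) : Convex ℝ {u | u - g ∈ H10 Ω} :=
  convex_sub_mem (testSubmodule Ω).topologicalClosure g

theorem isClosed_sub_mem_H10 (g : H1 Ω) : IsClosed {u | u - g ∈ H10 Ω} :=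
  isClosed_closure.preimage (continuous_id.sub continuous_const)

theorem zero_mem_H10 : (0 : H1 Ω) ∈ H10 Ω := (testSubmodule Ω).topologicalClosure.zero_mem

/-- Cutting f and h off outside A turns the integral into a bounded pairing on Ω; this makes the
trace functional continuous on H¹. -/
theorem exists_neg_setIntegral_eq {A : Set (E d)} (hA : MeasurableSet A) (hAΩ : A ⊆ Ω)
    {f h : E d → ℝ} (hf : MemLp f 2 (volume.restrict Ω)) (hh : MemLp h 2 (volume.restrict Ω))
    (i : Fin d) :
    ∃ T : H1 Ω →L[ℝ] ℝ, ∀ u, -∫ x in A, (fn u x * f x + grad u x i * h x) = T u := by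
  refine ⟨pairingL (hf.neg.indicator hA) (hh.neg.indicator hA) (EuclideanSpace.single i 1),
    fun u => ?_⟩
  have key : ∫ x in Ω, A.indicator (fun x => fn u x * f x + grad u x i * h x) x
      = ∫ x in A, (fn u x * f x + grad u x i * h x) := by
    rw [setIntegral_indicator hA, inter_eq_right.2 hAΩ]
  rw [← key, ← integral_neg, pairingL_apply]
  refine integral_congr_ae (ae_of_all _ fun x => ?_)
  by_cases hx : x ∈ A
  · simp only [hx, indicator_of_mem, Pi.neg_apply, EuclideanSpace.inner_single_right, conj_trivial,
      one_mul]
    ring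
  · simp only [hx, not_false_eq_true, indicator_of_notMem, mul_zero, add_zero, neg_zero]

end Affine

/-! ### The obstacle problem: energy and admissible set. -/

theorem isOpen_ball1 (d : ℕ) : IsOpen (ball1 d) := Metric.isOpen_ball

theorem convex_nonneg (d : ℕ) : Convex ℝ {u : H1 (ball1 d) | Nonneg u} := by
  intro u hu v hv a b ha hb _
  filter_upwards [hu, hv, Lp.coeFn_add (a • fn u) (b • fn v), Lp.coeFn_smul a (fn u),
    Lp.coeFn_smul b (fn v)] with x h1 h2 h3 h4 h5
  change 0 ≤ (a • fn u + b • fn v : L2 (ball1 d)) x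
  rw [h3, Pi.add_apply, h4, h5, Pi.smul_apply, Pi.smul_apply, smul_eq_mul, smul_eq_mul]
  positivity

theorem isClosed_nonneg (d : ℕ) : IsClosed {u : H1 (ball1 d) | Nonneg u} := by
  have h : {u : H1 (ball1 d) | Nonneg u} = fn ⁻¹' {f : L2 (ball1 d) | 0 ≤ f} := by
    ext u
    exact Lp.coeFn_nonneg (fn u)
  rw [h]
  exact isClosed_Ici.preimage continuous_fn

/-- The ball has finite measure, so 1 ∈ L² and u ↦ ∫ u is continuous. The direction 0 removes the
gradient term of the pairing. -/
theorem Fob_eq (d : ℕ) : ∃ ℓ : H1 (ball1 d) →L[ℝ] ℝ, Fob = quadEnergy (gradL (ball1 d)) ℓ := by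
  have : Fact (volume (ball1 d) < ⊤) := ⟨measure_ball_lt_top⟩
  have h1 : MemLp (fun _ : E d => (1 : ℝ)) 2 (volume.restrict (ball1 d)) := memLp_const 1
  refine ⟨pairingL h1 h1 0, funext fun u => ?_⟩
  have h2 := pairingL_apply h1 h1 0 u
  simp only [mul_one, inner_zero_right, add_zero] at h2
  exact congrArg₂ (fun a b : ℝ => 1 / 2 * a + b) (integral_norm_sq_grad u) h2.symm

theorem isClosed_Kob {d : ℕ} (g : H1 (ball1 d)) : IsClosed (Kob g) :=
  IsClosed.inter (isClosed_sub_mem_H10 g) (isClosed_nonneg d)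

theorem convex_Kob {d : ℕ} (g : H1 (ball1 d)) : Convex ℝ (Kob g) :=
  Convex.inter (convex_sub_mem_H10 g) (convex_nonneg d)

theorem self_mem_Kob {d : ℕ} {g : H1 (ball1 d)} (hg : Nonneg g) : g ∈ Kob g :=
  ⟨(sub_self g).symm ▸ zero_mem_H10, hg⟩

/-! ### The thin-obstacle problem: energy and admissible set. -/

section Thin

variable {n : ℕ}

theorem Fth_eq (n : ℕ) : ∃ ℓ : H1 (ball1 (n + 1)) →L[ℝ] ℝ,
    Fth = quadEnergy (gradL (ball1 (n + 1))) ℓ :=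
  ⟨0, funext fun u => (congrArg (fun a : ℝ => 1 / 2 * a) (integral_norm_sq_grad u)).trans
    (quadEnergy_zero (gradL (ball1 (n + 1))) u).symm⟩

theorem measurableSet_halfBall (n : ℕ) : MeasurableSet (halfBall n) :=
  ((isOpen_ball1 (n + 1)).inter (isOpen_lt continuous_const (by fun_prop))).measurableSet

theorem exists_thinTrace_eq {n : ℕ} {ψ : E (n + 1) → ℝ} (hψ : IsTest (ball1 (n + 1)) ψ) :
    ∃ T : H1 (ball1 (n + 1)) →L[ℝ] ℝ, ∀ u, thinTrace u ψ = T u :=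
  exists_neg_setIntegral_eq (measurableSet_halfBall n) inter_subset_left
    (hψ.memLp_fderiv (EuclideanSpace.single (Fin.last n) 1)) hψ.memLp (Fin.last n)

/-- Presents the trace constraint as an intersection of closed half-spaces, from which convexity and
closedness follow at once. -/
theorem exists_thinNonneg_eq (n : ℕ) :
    ∃ T : {ψ : E (n + 1) → ℝ // IsTest (ball1 (n + 1)) ψ ∧ ∀ x, 0 ≤ ψ x} →
      H1 (ball1 (n + 1)) →L[ℝ] ℝ, {u | ThinNonneg u} = {u | ∀ i, 0 ≤ T i u} := by
  choose T hT using fun i : {ψ : E (n + 1) → ℝ // IsTest (ball1 (n + 1)) ψ ∧ ∀ x, 0 ≤ ψ x} =>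
    exists_thinTrace_eq i.2.1
  refine ⟨T, Set.ext fun u => ⟨fun h i => ?_, fun h ψ hψ h0 => ?_⟩⟩
  · exact (h i.1 i.2.1 i.2.2).trans_eq (hT i u)
  · exact (h ⟨ψ, hψ, h0⟩).trans_eq (hT ⟨ψ, hψ, h0⟩ u).symm

theorem convex_thinNonneg (n : ℕ) : Convex ℝ {u : H1 (ball1 (n + 1)) | ThinNonneg u} := by
  obtain ⟨T, hT⟩ := exists_thinNonneg_eq n
  rw [hT]
  exact convex_setOf_forall_nonneg T

theorem isClosed_thinNonneg (n : ℕ) : IsClosed {u : H1 (ball1 (n + 1)) | ThinNonneg u} := by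
  obtain ⟨T, hT⟩ := exists_thinNonneg_eq n
  rw [hT]
  exact isClosed_setOf_forall_nonneg T

theorem measurePreserving_reflect :
    MeasurePreserving (reflect : E (n + 1) → E (n + 1)) (volume.restrict (ball1 (n + 1)))
      (volume.restrict (ball1 (n + 1))) := by
  let R : E (n + 1) ≃ₗᵢ[ℝ] E (n + 1) := LinearIsometryEquiv.piLpCongrRight 2 fun i =>
    if i = Fin.last n then LinearIsometryEquiv.neg ℝ else LinearIsometryEquiv.refl ℝ ℝ
  have hR : (reflect : E (n + 1) → E (n + 1)) = R := by
    funext x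
    ext i
    simp only [R, reflect, LinearIsometryEquiv.piLpCongrRight_apply]
    split_ifs <;> simp
  have h := R.measurePreserving.restrict_preimage (isOpen_ball1 (n + 1)).measurableSet
  have hb : R ⁻¹' ball1 (n + 1) = ball1 (n + 1) := by
    ext x
    simp [ball1]
  rwa [hb, ← hR] at h

/-- Composition with the reflection, on `L²(B₁)`. -/
noncomputable def reflectL : L2 (ball1 (n + 1)) →L[ℝ] L2 (ball1 (n + 1)) :=
  (Lp.compMeasurePreservingₗᵢ ℝ reflect measurePreserving_reflect).toContinuousLinearMap

/-- As a fixed-point equation for a continuous linear operator, evenness is a closed linear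
condition. -/
theorem isEven_iff (u : H1 (ball1 (n + 1))) : IsEven u ↔ reflectL (fn u) = fn u := by
  have h : reflectL (fn u) =ᵐ[volume.restrict (ball1 (n + 1))] fun x => fn u (reflect x) :=
    Lp.coeFn_compMeasurePreserving (fn u) measurePreserving_reflect
  rw [Lp.ext_iff]
  exact ⟨fun hu => h.trans hu, fun hu => h.symm.trans hu⟩

theorem convex_isEven : Convex ℝ {u : H1 (ball1 (n + 1)) | IsEven u} := by
  intro u hu v hv a b _ _ _
  rw [mem_ofPred_eq, isEven_iff] at hu hv ⊢
  change reflectL (a • fn u + b • fn v) = a • fn u + b • fn v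
  rw [map_add, map_smul, map_smul, hu, hv]

theorem isClosed_isEven : IsClosed {u : H1 (ball1 (n + 1)) | IsEven u} := by
  simp_rw [isEven_iff]
  exact isClosed_eq (by fun_prop) (by fun_prop)

theorem isClosed_Kth (g : H1 (ball1 (n + 1))) : IsClosed (Kth g) :=
  IsClosed.inter (isClosed_sub_mem_H10 g) (IsClosed.inter (isClosed_thinNonneg n) isClosed_isEven)

theorem convex_Kth (g : H1 (ball1 (n + 1))) : Convex ℝ (Kth g) :=
  Convex.inter (convex_sub_mem_H10 g) (Convex.inter (convex_thinNonneg n) convex_isEven)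

theorem self_mem_Kth {g : H1 (ball1 (n + 1))} (hg : ThinNonneg g) (hg' : IsEven g) : g ∈ Kth g :=
  ⟨(sub_self g).symm ▸ zero_mem_H10, hg, hg'⟩

end Thin

end ObstacleFlow

theorem theorem1p4 (n : ℕ) :
    -- the obstacle problem in the unit ball of `ℝ^d`, `d = n + 1 ≥ 1`
    (∀ g : H1 (ball1 (n + 1)), Nonneg g →
      (∃! φ, IsMinimizer Fob (Kob g) φ) ∧
      ∀ (φ : H1 (ball1 (n + 1))) (u : ℝ → H1 (ball1 (n + 1))),
        IsMinimizer Fob (Kob g) φ →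
        IsStrongSolution Fob (Kob g) (ball1 (n + 1)) u →
        Tendsto u atTop (𝓝 φ) ∧
        ∃ C > 0, ∃ M > 0, ∀ t : ℝ, 1 ≤ t → ‖u t - φ‖ ≤ M * Real.exp (-C * t)) ∧
    -- the thin-obstacle problem in the unit ball of `ℝ^d`, `d = n + 1 ≥ 2`
    (1 ≤ n → ∀ g : H1 (ball1 (n + 1)), ThinNonneg g → IsEven g →
      (∃! φ, IsMinimizer Fth (Kth g) φ) ∧
      ∀ (φ : H1 (ball1 (n + 1))) (u : ℝ → H1 (ball1 (n + 1))),
        IsMinimizer Fth (Kth g) φ →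
        IsStrongSolution Fth (Kth g) (halfBall n) u →
        Tendsto u atTop (𝓝 φ) ∧
        ∃ C > 0, ∃ M > 0, ∀ t : ℝ, 1 ≤ t → ‖u t - φ‖ ≤ M * Real.exp (-C * t)) := by
  refine ⟨fun g hg => (Fob_eq (n + 1)).elim fun ℓ hℓ => ?_,
    fun _ g hg hg' => (Fth_eq n).elim fun ℓ hℓ => ?_⟩
  -- The Poincaré constant κ = 3 serves both problems, so the rate obtained is 1/9 in each.
  · have h := stationary_and_convergence (Ω' := ball1 (n + 1)) (isOpen_ball1 (n + 1)) hℓ three_pos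
      (fun _ => norm_le_of_mem_H10) (self_mem_Kob hg) (fun _ h => h.1) (isClosed_Kob g)
      (convex_Kob g)
    exact h
  · have h := stationary_and_convergence (Ω' := halfBall n) (isOpen_ball1 (n + 1)) hℓ three_pos
      (fun _ => norm_le_of_mem_H10) (self_mem_Kth hg hg') (fun _ h => h.1) (isClosed_Kth g)
      (convex_Kth g)
    exact h
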